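/- Let $Q$ be a finite quandle, with operation $\triangleright$. Let $\mathrm{Inn}(Q)$ be the group of permutations of $Q$ generated by the left translations $L_x : y \mapsto x \triangleright y$, let $G(Q) = \langle x \in Q \mid xyx^{-1} = x \triangleright y \text{ for } x,y\in Q\rangle$ be the enveloping group of $Q$, and let $Z_0$ be the kernel of the surjective group morphism $\theta_{G(Q)} : G(Q) \to \mathrm{Inn}(Q)$ that maps the generator $x$ to $L_x$; it is a central, hence abelian, subgroup of $G(Q)$. A representation of $Q$ on a complex vector space $V$ is a map $\rho : Q \to GL(V)$ with $\rho(x \triangleright y) = \rho(x)\rho(y)\rho(x)^{-1}$ for all $x, y \in Q$, and $\rho_{G(Q)} : G(Q) \to GL(V)$ denotes the group morphism that extends it. It is irreducible if $V \neq 0$ and the only subspaces $W$ with $\rho(x)(W) \subset W$ for all $x \in Q$ are $0$ and $V$. A projective representation of a group $G$ is a group morphism $P : G \to PGL(V)$; it is irreducible if $V \ne 0$ and no subspace other than $0$ and $V$ is stable under $G$. If $V \neq 0$, its class in $H^2(G, \mathbb{C}^\times)$ (trivial action) is the class of the cocycle $\alpha$ with $\tilde P(gh) = \alpha(g,h)\,\tilde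 P(g)\tilde P(h)$, where $\tilde P : G \to GL(V)$ is any lift of $P$ with $\tilde P(1) = \mathrm{Id}$. A projective representation $P$ of $\mathrm{Inn}(Q)$ on $V$ is induced by a representation $\rho$ of $Q$ on $V$ if $P(\theta_{G(Q)}(g))$ is the class of $\rho_{G(Q)}(g)$ in $PGL(V)$ for every $g \in G(Q)$. Every irreducible representation of $Q$ over $\mathbb{C}$ induces exactly one projective representation of $\mathrm{Inn}(Q)$, and this one is irreducible. The set $M_Q \subset H^2(\mathrm{Inn}(Q), \mathbb{C}^\times)$ of the classes of the irreducible projective representations of $\mathrm{Inn}(Q)$ induced by irreducible representations of $Q$ is a subgroup of the Schur multiplier $H^2(\mathrm{Inn}(Q), \mathbb{C}^\times)$. The torsion subgroup $\mathrm{Tor}(Z_0)$ of $Z_0$ is finite, and $M_Q$ is isomorphic to $\mathrm{Tor}(Z_0)$. Moreover, an irreducible projective representation of $\mathrm{Inn}(Q)$ over $\mathbb{C}$ has its class in $M_Q$ if and only if it is induced by an irreducible representation of $Q$. -/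

import Mathlib

open scoped Quandles

universe u v

/-! ### The Schur multiplier `H²(G, ℂˣ)` (trivial action) -/

section SchurMultiplier

variable (G : Type*) [Group G]

/-- Multiplicative 2-cocycles `G × G → ℂˣ` for the trivial action of `G` on `ℂˣ`. -/
def schurCocycles : Subgroup (G × G → ℂˣ) where
  carrier := {f | ∀ g h j : G, f (g * h, j) * f (g, h) = f (h, j) * f (g, h * j)}
  mul_mem' := by
    intro a b ha hb g h j
    simp only [Pi.mul_apply]
    rw [mul_mul_mul_comm, ha g h j, hb g h j, mul_mul_mul_comm]
  one_mem' := by intro g h j; simp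
  inv_mem' := by
    intro a ha g h j
    simp only [Pi.inv_apply]
    rw [← mul_inv, ha g h j, mul_inv]

/-- The coboundary map sending `x : G → ℂˣ` to `(g, h) ↦ x h / x (g * h) * x g`. -/
def schurCoboundary : (G → ℂˣ) →* schurCocycles G where
  toFun x := ⟨fun p => x p.2 / x (p.1 * p.2) * x p.1, by
    intro g h j
    simp only [div_eq_mul_inv, mul_assoc]
    have e : x j * ((x (g * (h * j)))⁻¹ * (x (g * h) * (x h * ((x (g * h))⁻¹ * x g))))
      = x j * ((x (g * (h * j)))⁻¹ * (x h * (x g * (x (g * h) * (x (g * h))⁻¹)))) := by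
      ac_rfl
    have e' : x j * ((x (h * j))⁻¹ * (x h * (x (h * j) * ((x (g * (h * j)))⁻¹ * x g))))
      = x j * ((x (g * (h * j)))⁻¹ * (x h * (x g * (x (h * j) * (x (h * j))⁻¹)))) := by
      ac_rfl
    rw [e, e', mul_inv_cancel, mul_inv_cancel]⟩
  map_one' := by ext; simp
  map_mul' := by
    intro x y
    apply Subtype.ext
    funext p
    simp only [Pi.mul_apply, Subgroup.coe_mul, div_eq_mul_inv, mul_inv]
    ac_rfl

/-- The Schur multiplier `H²(G, ℂˣ)`: 2-cocycles modulo 2-coboundaries. Mathlib's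
`groupCohomology` over `ℤ` only covers groups in the universe `Type`; there the two agree, see
`schurMultiplier_equiv_H2`. -/
abbrev SchurMultiplier : Type _ := schurCocycles G ⧸ (schurCoboundary G).range

end SchurMultiplier

/-- In the universe `Type`, `SchurMultiplier G` is Mathlib's `H²` of the trivial representation
of `G` on `ℂˣ`. -/
theorem schurMultiplier_equiv_H2 (G : Type) [Group G] :
    Nonempty (Additive (SchurMultiplier G) ≃+
      groupCohomology.H2 (Rep.trivial ℤ G (Additive ℂˣ))) := by
  let A := Rep.trivial ℤ G (Additive ℂˣ)
  let c : schurCocycles G → groupCohomology.cocycles₂ A := fun f =>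
    ⟨fun p => Additive.ofMul (f.1 p), (groupCohomology.mem_cocycles₂_iff (A := A) _).2
      fun g h j => congrArg Additive.ofMul (f.2 g h j)⟩
  let φ : Additive (schurCocycles G) →+ groupCohomology.H2 A :=
    { toFun := fun f => groupCohomology.H2π A (c f.toMul)
      map_zero' := (groupCohomology.H2π A).hom.map_zero
      map_add' := fun f g => (groupCohomology.H2π A).hom.map_add (c f.toMul) (c g.toMul) }
  have hker : ∀ f : schurCocycles G,
      φ (Additive.ofMul f) = 0 ↔ f ∈ (schurCoboundary G).range := by
    intro f
    refine (groupCohomology.H2π_eq_zero_iff (c f)).trans ⟨?_, ?_⟩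
    · rintro ⟨x, hx⟩
      exact ⟨fun g => (x g).toMul, Subtype.ext (funext fun p => congrFun hx p)⟩
    · rintro ⟨x, rfl⟩
      exact ⟨fun g => Additive.ofMul (x g), rfl⟩
  let ψ : SchurMultiplier G →* Multiplicative (groupCohomology.H2 A) :=
    QuotientGroup.lift _ (AddMonoidHom.toMultiplicativeRight φ) fun f hf => (hker f).2 hf
  have hψ : Function.Bijective ψ := by
    constructor
    · rw [injective_iff_map_eq_one]
      intro q
      induction q using QuotientGroup.induction_on with
      | H f => exact fun h => (QuotientGroup.eq_one_iff f).2 ((hker f).1 h)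
    · intro y
      induction y using groupCohomology.H2_induction_on with
      | h x =>
        exact ⟨QuotientGroup.mk ⟨fun p => (x.1 p).toMul,
          fun g h j => (groupCohomology.mem_cocycles₂_iff (A := A) x.1).1 x.2 g h j⟩, rfl⟩
  exact ⟨MulEquiv.toAdditiveLeft (MulEquiv.ofBijective ψ hψ)⟩

/-! ### Projective representations and their classes -/

section Projective

variable (V : Type*) [AddCommGroup V] [Module ℂ V]

/-- The scalar operator attached to a nonzero complex number. -/
def scalarGL : ℂˣ →* LinearMap.GeneralLinearGroup ℂ V :=
  Units.map (algebraMap ℂ (Module.End ℂ V) : ℂ →* Module.End ℂ V)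

variable {V} in
theorem scalarGL_comm (c : ℂˣ) (T : LinearMap.GeneralLinearGroup ℂ V) :
    scalarGL V c * T = T * scalarGL V c :=
  Units.ext (Algebra.commutes (c : ℂ) (T : Module.End ℂ V))

theorem scalarGL_injective [Nontrivial V] : Function.Injective (scalarGL V) := by
  intro c d h
  exact Units.ext ((algebraMap ℂ (Module.End ℂ V)).injective (congrArg Units.val h))

instance : (scalarGL V).range.Normal where
  conj_mem := by
    rintro _ ⟨c, rfl⟩ T
    rw [← scalarGL_comm, mul_inv_cancel_right]
    exact ⟨c, rfl⟩

/-- `PGL(V)`: the general linear group modulo the nonzero scalars. -/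
abbrev PGL : Type _ := LinearMap.GeneralLinearGroup ℂ V ⧸ (scalarGL V).range

variable {V}
variable {G : Type*} [Group G]

/-- A projective representation is irreducible if `V ≠ 0` and the only subspaces of `V` stable
under (all representatives of) all the `P g` are `0` and `V`. -/
def IsIrreducibleProj (P : G →* PGL V) : Prop :=
  Nontrivial V ∧ ∀ W : Submodule ℂ V,
    (∀ (g : G) (T : LinearMap.GeneralLinearGroup ℂ V), (T : PGL V) = P g →
      ∀ w ∈ W, (T : Module.End ℂ V) w ∈ W) → W = ⊥ ∨ W = ⊤

/-- `s` is a normalized set-theoretic lift of the projective representation `P` to `GL(V)`. -/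
def IsLift (P : G →* PGL V) (s : G → LinearMap.GeneralLinearGroup ℂ V) : Prop :=
  s 1 = 1 ∧ ∀ g, (s g : PGL V) = P g

/-- `s (gh) = α(g, h) s(g) s(h)`. -/
def IsFactorSet (s : G → LinearMap.GeneralLinearGroup ℂ V) (α : G × G → ℂˣ) : Prop :=
  ∀ g h, s (g * h) = scalarGL V (α (g, h)) * (s g * s h)

theorem exists_isLift (P : G →* PGL V) : ∃ s, IsLift P s := by
  classical
  refine ⟨fun g => if g = 1 then 1 else (P g).out, if_pos rfl, fun g => ?_⟩
  by_cases hg : g = 1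
  · subst hg; simp
  · simp [hg]

theorem IsLift.exists_isFactorSet {P : G →* PGL V} {s : G → LinearMap.GeneralLinearGroup ℂ V}
    (hs : IsLift P s) : ∃ α, IsFactorSet s α := by
  have key : ∀ p : G × G, ∃ c : ℂˣ, s (p.1 * p.2) = scalarGL V c * (s p.1 * s p.2) := by
    intro p
    have h : ((s p.1 * s p.2 : LinearMap.GeneralLinearGroup ℂ V) : PGL V) = s (p.1 * p.2) := by
      rw [QuotientGroup.mk_mul, hs.2, hs.2, hs.2, map_mul]
    obtain ⟨c, hc⟩ := QuotientGroup.eq.1 h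
    exact ⟨c, by rw [scalarGL_comm, hc, mul_inv_cancel_left]⟩
  choose α hα using key
  exact ⟨α, fun g h => hα (g, h)⟩

theorem IsFactorSet.mem_schurCocycles [Nontrivial V]
    {s : G → LinearMap.GeneralLinearGroup ℂ V} {α : G × G → ℂˣ} (hα : IsFactorSet s α) :
    α ∈ schurCocycles G := by
  intro g h j
  apply scalarGL_injective V
  have h1 : s (g * h * j) = scalarGL V (α (g * h, j) * α (g, h)) * (s g * s h * s j) := by
    rw [hα (g * h) j, hα g h, map_mul]; simp only [mul_assoc]
  have h2 : s (g * h * j) = scalarGL V (α (h, j) * α (g, h * j)) * (s g * s h * s j) := by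
    rw [mul_assoc, hα g (h * j), hα h j, mul_comm (α (h, j)), map_mul, ← mul_assoc (s g),
      ← scalarGL_comm]
    simp only [mul_assoc]
  exact mul_right_cancel (h1.symm.trans h2)

/-- The class in `H²(G, ℂˣ)` of a projective representation `P` on `V ≠ 0`: the class of the
cocycle `α` defined by `s (gh) = α(g, h) s(g) s(h)` for a normalized lift `s` of `P`. It does not
depend on the choice of `s`, see `schurClass_eq`. -/
noncomputable def schurClass [Nontrivial V] (P : G →* PGL V) : SchurMultiplier G :=
  QuotientGroup.mk ⟨(exists_isLift P).choose_spec.exists_isFactorSet.choose,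
    (exists_isLift P).choose_spec.exists_isFactorSet.choose_spec.mem_schurCocycles⟩

theorem schurClass_eq [Nontrivial V] {P : G →* PGL V}
    {s : G → LinearMap.GeneralLinearGroup ℂ V} (hs : IsLift P s) {α : G × G → ℂˣ}
    (hα : IsFactorSet s α) :
    schurClass P = QuotientGroup.mk ⟨α, hα.mem_schurCocycles⟩ := by
  unfold schurClass
  generalize_proofs hs₀ hα₀ hm
  set s' := hs₀.choose
  have hs' : IsLift P s' := hs₀.choose_spec
  set α' := hα₀.choose
  have hα' : IsFactorSet s' α' := hα₀.choose_spec
  have key : ∀ g, ∃ c : ℂˣ, s g = scalarGL V c * s' g := by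
    intro g
    obtain ⟨c, hc⟩ := QuotientGroup.eq.1 ((hs'.2 g).trans (hs.2 g).symm)
    exact ⟨c, by rw [scalarGL_comm, hc, mul_inv_cancel_left]⟩
  choose x hx using key
  rw [QuotientGroup.eq]
  refine ⟨x⁻¹, Subtype.ext (funext fun p => ?_)⟩
  obtain ⟨g, h⟩ := p
  have e : scalarGL V (x (g * h) * α' (g, h)) * (s' g * s' h)
      = scalarGL V (α (g, h) * x g * x h) * (s' g * s' h) := by
    have e1 := hα g h
    rw [hx (g * h), hα' g h, hx g, hx h] at e1
    simp only [map_mul, mul_assoc] at e1 ⊢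
    rw [e1, ← mul_assoc (s' g), ← scalarGL_comm]
    simp only [mul_assoc]
  have e2 : x (g * h) * α' (g, h) = α (g, h) * x g * x h :=
    scalarGL_injective V (mul_right_cancel e)
  change (x h)⁻¹ / (x (g * h))⁻¹ * (x g)⁻¹ = (α' (g, h))⁻¹ * α (g, h)
  have e3 : α (g, h) = x (g * h) * α' (g, h) * (x h)⁻¹ * (x g)⁻¹ := by
    rw [e2, mul_inv_cancel_right, mul_inv_cancel_right]
  have e4 : (α' (g, h))⁻¹ * α (g, h) = (α' (g, h))⁻¹ * α' (g, h) *
      ((x h)⁻¹ * x (g * h) * (x g)⁻¹) := by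
    rw [e3]; ac_rfl
  rw [e4, inv_mul_cancel, one_mul, div_inv_eq_mul]

end Projective

/-! ### Quandles: inner automorphisms, enveloping group, representations -/

section Quandles

variable (Q : Type*) [Quandle Q]

/-- The group of inner automorphisms of `Q`, generated by the left translations. -/
def Inn : Subgroup (Equiv.Perm Q) := Subgroup.closure (Set.range (Rack.act' : Q → Equiv.Perm Q))

/-- The quandle morphism `θ : Q → Conj(Inn(Q))`, `x ↦ L_x`. -/
def toInn : Q →◃ Quandle.Conj (Inn Q) where
  toFun x := ⟨Rack.act' x, Subgroup.subset_closure ⟨x, rfl⟩⟩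
  map_act' := by
    intro x y
    exact Subtype.ext (Rack.ad_conj x y)

/-- The group morphism `G(Q) → Inn(Q)` induced by `θ`. -/
def envelToInn : Rack.EnvelGroup Q →* Inn Q := Rack.toEnvelGroup.map (toInn Q)

/-- `Z₀`, the kernel of `G(Q) → Inn(Q)`. -/
def Z0 : Subgroup (Rack.EnvelGroup Q) := (envelToInn Q).ker

variable {Q} in
/-- Conjugation by `g` in `G(Q)` acts on generators through the image of `g` in `Inn(Q)`. -/
theorem envel_conj (g : Rack.EnvelGroup Q) :
    ∀ x : Q, g * (Rack.toEnvelGroup Q x : Rack.EnvelGroup Q) * g⁻¹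
      = Rack.toEnvelGroup Q ((envelToInn Q g : Equiv.Perm Q) x) := by
  have hmul : ∀ a b : Rack.EnvelGroup Q,
      (∀ x : Q, a * (Rack.toEnvelGroup Q x : Rack.EnvelGroup Q) * a⁻¹
        = Rack.toEnvelGroup Q ((envelToInn Q a : Equiv.Perm Q) x)) →
      (∀ x : Q, b * (Rack.toEnvelGroup Q x : Rack.EnvelGroup Q) * b⁻¹
        = Rack.toEnvelGroup Q ((envelToInn Q b : Equiv.Perm Q) x)) →
      ∀ x : Q, (a * b) * (Rack.toEnvelGroup Q x : Rack.EnvelGroup Q) * (a * b)⁻¹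
        = Rack.toEnvelGroup Q ((envelToInn Q (a * b) : Equiv.Perm Q) x) := by
    intro a b iha ihb x
    rw [map_mul, Subgroup.coe_mul, Equiv.Perm.mul_apply, ← iha, ← ihb]
    simp only [mul_inv_rev, mul_assoc]
  have hinv : ∀ a : Rack.EnvelGroup Q,
      (∀ x : Q, a * (Rack.toEnvelGroup Q x : Rack.EnvelGroup Q) * a⁻¹
        = Rack.toEnvelGroup Q ((envelToInn Q a : Equiv.Perm Q) x)) →
      ∀ x : Q, a⁻¹ * (Rack.toEnvelGroup Q x : Rack.EnvelGroup Q) * (a⁻¹)⁻¹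
        = Rack.toEnvelGroup Q ((envelToInn Q a⁻¹ : Equiv.Perm Q) x) := by
    intro a iha x
    have h := iha ((envelToInn Q a : Equiv.Perm Q)⁻¹ x)
    rw [show (envelToInn Q a : Equiv.Perm Q) ((envelToInn Q a : Equiv.Perm Q)⁻¹ x) = x from
      Equiv.apply_symm_apply _ x] at h
    rw [map_inv, Subgroup.coe_inv, ← h]
    simp only [mul_assoc, inv_mul_cancel_left, inv_inv, inv_mul_cancel, mul_one]
  induction g using Quotient.inductionOn with
  | h a =>
    induction a with
    | unit =>
      intro x
      change (1 : Rack.EnvelGroup Q) * _ * 1⁻¹ = _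
      rw [one_mul, inv_one, mul_one]
      rfl
    | incl y => exact fun x => ((Rack.toEnvelGroup Q).map_act (x := y) (y := x)).symm
    | mul a b iha ihb => exact hmul _ _ iha ihb
    | inv a iha => exact hinv _ iha

variable {Q} in
/-- `Z₀` is central in `G(Q)`. -/
theorem Z0_comm {z : Rack.EnvelGroup Q} (hz : z ∈ Z0 Q) (g : Rack.EnvelGroup Q) :
    z * g = g * z := by
  have hz' : envelToInn Q z = 1 := hz
  have hx : ∀ x : Q, z * (Rack.toEnvelGroup Q x : Rack.EnvelGroup Q) * z⁻¹
      = Rack.toEnvelGroup Q x := by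
    intro x
    rw [envel_conj, hz']
    rfl
  have hom : (MulAut.conj z).toMonoidHom = MonoidHom.id (Rack.EnvelGroup Q) := by
    apply Rack.toEnvelGroup.map.symm.injective
    apply ShelfHom.ext
    funext x
    exact hx x
  have h : z * g * z⁻¹ = g := DFunLike.congr_fun hom g
  exact mul_inv_eq_iff_eq_mul.1 h

instance : CommGroup (Z0 Q) :=
  { Subgroup.toGroup (Z0 Q) with
    mul_comm := fun a b => Subtype.ext (Z0_comm a.2 b.1) }

variable {Q}
variable {V : Type*} [AddCommGroup V] [Module ℂ V]

/-- A linear quandle representation `ρ : Q → Conj(GL(V))` is irreducible if `V ≠ 0` and the only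
subspaces stable under all `ρ x` are `0` and `V`. -/
def IsIrreducibleRep (ρ : Q →◃ Quandle.Conj (LinearMap.GeneralLinearGroup ℂ V)) : Prop :=
  Nontrivial V ∧ ∀ W : Submodule ℂ V,
    (∀ x : Q, ∀ w ∈ W, ((ρ x : LinearMap.GeneralLinearGroup ℂ V) : Module.End ℂ V) w ∈ W) →
      W = ⊥ ∨ W = ⊤

/-- `P` is the projective representation of `Inn(Q)` induced by `ρ`: for every `g ∈ G(Q)`, the
value of `P` at the image of `g` in `Inn(Q)` is the class of `ρ_{G(Q)}(g)` in `PGL(V)`, where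
`ρ_{G(Q)} : G(Q) → GL(V)` is the extension of `ρ`. Since `G(Q) → Inn(Q)` is onto, this says that
`P a` is the class of `ρ_{G(Q)}(s a)` for any section `s`, and it determines `P`. -/
def IsInducedBy (P : Inn Q →* PGL V)
    (ρ : Q →◃ Quandle.Conj (LinearMap.GeneralLinearGroup ℂ V)) : Prop :=
  ∀ g : Rack.EnvelGroup Q, P (envelToInn Q g) =
    ((Rack.toEnvelGroup.map ρ g : LinearMap.GeneralLinearGroup ℂ V) : PGL V)

variable (Q) in
/-- The classes in `H²(Inn(Q), ℂˣ)` of the irreducible projective representations of `Inn(Q)`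
induced by irreducible representations of `Q`. -/
def inducedClasses : Set (SchurMultiplier (Inn Q)) :=
  {c | ∃ (V : Type) (_ : AddCommGroup V) (_ : Module ℂ V) (_ : Nontrivial V)
    (ρ : Q →◃ Quandle.Conj (LinearMap.GeneralLinearGroup ℂ V)) (P : Inn Q →* PGL V),
    IsIrreducibleRep ρ ∧ IsIrreducibleProj P ∧ IsInducedBy P ρ ∧ schurClass P = c}

end Quandles

/-! ### `G(Q)` as a central extension of `Inn(Q)`, and its transgression map. -/

section EnvelopingGroup

variable {Q : Type*} [Quandle Q]

/-! A section of `G(Q) → Inn(Q)` has a factor set with values in the central subgroup `Z₀`.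
Composing it with characters gives the transgression `Hom(Z₀, ℂˣ) → H²(Inn(Q), ℂˣ)`, and `M_Q` is
its image. By Schur's lemma, `Z₀` acts on an irreducible `ρ` by a character `χ`, and the induced
projective representation has class `transgression χ` (`IsInducedBy.schurClass_eq`). Every `χ`
occurs, in a minimal subrepresentation of the representation induced from `χ`. A projective
representation of class `transgression χ` can be rescaled to have factor set `χ ∘ innFactor`, so it
comes from a representation of `Q` (`exists_isInducedBy_of_schurClass_eq`).

The kernel of the transgression consists of the characters that extend to `G(Q)`; as `ℂˣ` is
divisible, these are the ones trivial on `Z₀ ∩ [G(Q), G(Q)]`. This intersection is `Tor(Z₀)`: the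
abelianization of `G(Q)` is torsion-free, and `[G(Q), G(Q)]` is finite because `Z₀` is central with
finite quotient `Inn(Q)`. Hence `M_Q` is isomorphic to the dual of the finite group `Tor(Z₀)`, so to
`Tor(Z₀)` itself.

Since `V` may be infinite-dimensional, Schur's lemma is proved in countable dimension, and stability
under inverses needs an argument. -/

theorem envel_induction {p : Rack.EnvelGroup Q → Prop} (one : p 1)
    (gen : ∀ x : Q, p (Rack.toEnvelGroup Q x)) (mul : ∀ a b, p a → p b → p (a * b))
    (inv : ∀ a, p a → p a⁻¹) (g : Rack.EnvelGroup Q) : p g := by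
  induction g using Quotient.inductionOn with
  | h a =>
    induction a with
    | unit => exact one
    | incl y => exact gen y
    | mul a b iha ihb => exact mul _ _ iha ihb
    | inv a iha => exact inv _ iha

theorem envelMap_toEnvelGroup {H : Type*} [Group H] (f : Q →◃ Quandle.Conj H) (x : Q) :
    Rack.toEnvelGroup.map f (Rack.toEnvelGroup Q x) = f x := rfl

theorem envelToInn_surjective : Function.Surjective (envelToInn Q) := by
  rintro ⟨a, ha⟩
  induction ha using Subgroup.closure_induction with
  | mem x hx =>
    obtain ⟨y, rfl⟩ := hx
    exact ⟨Rack.toEnvelGroup Q y, rfl⟩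
  | one => exact ⟨1, map_one _⟩
  | mul x y hx hy ihx ihy =>
    obtain ⟨g, hg⟩ := ihx
    obtain ⟨h, hh⟩ := ihy
    exact ⟨g * h, by rw [map_mul, hg, hh]; rfl⟩
  | inv x hx ih =>
    obtain ⟨g, hg⟩ := ih
    exact ⟨g⁻¹, by rw [map_inv, hg]; rfl⟩

/-- A normalized set-theoretic section of `G(Q) → Inn(Q)`. -/
noncomputable def innSection (a : Inn Q) : Rack.EnvelGroup Q :=
  (Function.surjInv envelToInn_surjective (1 : Inn Q))⁻¹ *
    Function.surjInv envelToInn_surjective a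

theorem envelToInn_innSection (a : Inn Q) : envelToInn Q (innSection a) = a := by
  rw [innSection, map_mul, map_inv, Function.surjInv_eq envelToInn_surjective,
    Function.surjInv_eq envelToInn_surjective, inv_one, one_mul]

theorem innSection_one : innSection (1 : Inn Q) = 1 := inv_mul_cancel _

/-- The factor set of the central extension `Z₀ → G(Q) → Inn(Q)`. -/
noncomputable def innFactor (p : Inn Q × Inn Q) : Z0 Q :=
  ⟨innSection (p.1 * p.2) * (innSection p.1 * innSection p.2)⁻¹, by
    change envelToInn Q _ = 1
    simp only [map_mul, map_inv, envelToInn_innSection, mul_inv_cancel]⟩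

theorem innSection_mul (a b : Inn Q) :
    innSection (a * b) = innFactor (a, b) * (innSection a * innSection b) :=
  (inv_mul_cancel_right _ _).symm

/-- Both sides are the central factor comparing the section at `a * b * c` with the product of its
three values. -/
theorem innFactor_cocycle (a b c : Inn Q) :
    innFactor (a * b, c) * innFactor (a, b) = innFactor (b, c) * innFactor (a, b * c) := by
  apply Subtype.ext
  have h1 := innSection_mul (a * b) c
  have h2 := innSection_mul a (b * c)
  rw [innSection_mul a b] at h1
  rw [innSection_mul b c, ← mul_assoc (innSection a), ← Z0_comm (innFactor (b, c)).2] at h2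
  rw [mul_assoc a b c, h2] at h1
  rw [mul_comm (innFactor (b, c))]
  refine mul_right_cancel (b := innSection a * innSection b * innSection c) ?_
  simpa only [Subgroup.coe_mul, mul_assoc] using h1.symm

/-- The component in `Z₀` of an element of `G(Q)` with respect to the section. -/
noncomputable def centralPart (g : Rack.EnvelGroup Q) : Z0 Q :=
  ⟨g * (innSection (envelToInn Q g))⁻¹, by
    change envelToInn Q _ = 1
    simp only [map_mul, map_inv, envelToInn_innSection, mul_inv_cancel]⟩

theorem centralPart_mul_innSection (g : Rack.EnvelGroup Q) :
    (centralPart g : Rack.EnvelGroup Q) * innSection (envelToInn Q g) = g := by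
  simp [centralPart]

theorem centralPart_coe (z : Z0 Q) : centralPart (z : Rack.EnvelGroup Q) = z := by
  have h : envelToInn Q z = 1 := z.2
  apply Subtype.ext
  simp [centralPart, h, innSection_one]

/-- The central part of `h` moves past the section value of `g`; the two section values then combine
through the factor set. -/
theorem centralPart_mul (g h : Rack.EnvelGroup Q) :
    centralPart g * centralPart h =
      centralPart (g * h) * innFactor (envelToInn Q g, envelToInn Q h) := by
  apply Subtype.ext
  have h1 := centralPart_mul_innSection (g * h)
  rw [map_mul, innSection_mul] at h1
  refine mul_right_cancel
    (b := innSection (envelToInn Q g) * innSection (envelToInn Q h)) ?_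
  rw [Subgroup.coe_mul, Subgroup.coe_mul, mul_assoc (centralPart (g * h) : Rack.EnvelGroup Q),
    h1, mul_assoc,
    ← mul_assoc (centralPart h : Rack.EnvelGroup Q), Z0_comm (centralPart h).2, mul_assoc,
    centralPart_mul_innSection, ← mul_assoc, centralPart_mul_innSection]

/-- A map `t` on `Inn(Q)` which is multiplicative up to the central elements `c (χ (z (a, b)))`
yields a morphism on `G(Q)`. -/
noncomputable def extendByCharacter {A H : Type*} [CommGroup A] [Group H] (c : A →* H)
    (hc : ∀ a h, c a * h = h * c a) (χ : Z0 Q →* A) (t : Inn Q → H)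
    (ht : ∀ a b, t (a * b) = c (χ (innFactor (a, b))) * (t a * t b)) :
    Rack.EnvelGroup Q →* H :=
  MonoidHom.mk' (fun g => c (χ (centralPart g)) * t (envelToInn Q g)) fun g h => by
    have h1 : c (χ (centralPart (g * h))) * c (χ (innFactor (envelToInn Q g, envelToInn Q h))) =
        c (χ (centralPart g)) * c (χ (centralPart h)) := by
      simp only [← map_mul, centralPart_mul]
    rw [map_mul, ht, ← mul_assoc, h1, mul_assoc, mul_assoc, ← mul_assoc (t _) (c _),
      ← hc (χ (centralPart h)), mul_assoc]

section

variable {A H : Type*} [CommGroup A] [Group H] {c : A →* H} {hc : ∀ a h, c a * h = h * c a}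
  {χ : Z0 Q →* A} {t : Inn Q → H}
  {ht : ∀ a b, t (a * b) = c (χ (innFactor (a, b))) * (t a * t b)}

theorem extendByCharacter_apply (g : Rack.EnvelGroup Q) :
    extendByCharacter c hc χ t ht g = c (χ (centralPart g)) * t (envelToInn Q g) := rfl

theorem innFactor_one_one : innFactor ((1 : Inn Q), 1) = 1 := by
  apply Subtype.ext
  simp [innFactor, innSection_one]

theorem extendByCharacter_coe (z : Z0 Q) : extendByCharacter c hc χ t ht z = c (χ z) := by
  have h1 : t 1 = 1 := by simpa [innFactor_one_one] using ht 1 1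
  have h : envelToInn Q z = 1 := z.2
  rw [extendByCharacter_apply, centralPart_coe, h, h1, mul_one]

end

/-- The cocycle on `Inn(Q)` attached to a character of `Z₀`. -/
noncomputable def characterCocycle : (Z0 Q →* ℂˣ) →* schurCocycles (Inn Q) where
  toFun χ := ⟨fun p => χ (innFactor p), fun a b c => by
    rw [← map_mul, innFactor_cocycle, map_mul]⟩
  map_one' := rfl
  map_mul' _ _ := rfl

/-- The transgression `Hom(Z₀, ℂˣ) → H²(Inn(Q), ℂˣ)`. -/
noncomputable def transgression : (Z0 Q →* ℂˣ) →* SchurMultiplier (Inn Q) :=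
  (QuotientGroup.mk' _).comp characterCocycle

/-- A trivialization `x` of the cocycle and an extension `ψ` of `χ` determine each other by `x a =
(ψ (innSection a))⁻¹`. -/
theorem transgression_eq_one_iff (χ : Z0 Q →* ℂˣ) :
    transgression χ = 1 ↔ ∃ ψ : Rack.EnvelGroup Q →* ℂˣ, ∀ z : Z0 Q, ψ z = χ z := by
  refine (QuotientGroup.eq_one_iff (characterCocycle χ)).trans ⟨?_, ?_⟩
  · rintro ⟨x, hx⟩
    have hx' : ∀ a b, x b / x (a * b) * x a = χ (innFactor (a, b)) := fun a b =>
      congrFun (congrArg Subtype.val hx) (a, b)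
    refine ⟨extendByCharacter (MonoidHom.id ℂˣ) (fun _ _ => mul_comm _ _) χ (fun a => (x a)⁻¹)
      fun a b => ?_, fun z => extendByCharacter_coe z⟩
    rw [MonoidHom.id_apply, ← hx', div_eq_mul_inv, ← mul_inv, mul_right_comm (x b), mul_comm (x b),
      mul_inv_cancel_comm]
  · rintro ⟨ψ, hψ⟩
    refine ⟨fun a => (ψ (innSection a))⁻¹, Subtype.ext (funext fun p => ?_)⟩
    obtain ⟨a, b⟩ := p
    change (ψ (innSection b))⁻¹ / (ψ (innSection (a * b)))⁻¹ * (ψ (innSection a))⁻¹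
      = χ (innFactor (a, b))
    rw [innSection_mul, map_mul, map_mul, hψ, div_inv_eq_mul, mul_comm (ψ (innSection a)),
      mul_left_comm, mul_assoc, inv_mul_cancel_left, mul_inv_cancel, mul_one]

end EnvelopingGroup

/-! ### Extension of characters, and finiteness of the commutator subgroup. -/

section Divisible

open scoped commutatorElement

/-- `ℂˣ` has all roots, so it is divisible and hence injective as a `ℤ`-module (Baer). The character
descends to `A ⧸ f.ker`, which embeds in `B`. -/
theorem exists_monoidHom_comp_eq {A B : Type*} [CommGroup A] [CommGroup B] (f : A →* B)
    (χ : A →* ℂˣ) (h : f.ker ≤ χ.ker) : ∃ ψ : B →* ℂˣ, ψ.comp f = χ := by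
  have hroot : ∀ {n : ℕ}, n ≠ 0 → Function.Surjective fun a : ℂˣ => a ^ n := fun {n} hn a => by
    obtain ⟨b, hb⟩ := IsAlgClosed.exists_pow_nat_eq (a : ℂ) (Nat.pos_of_ne_zero hn)
    have hb0 : b ≠ 0 := by
      rintro rfl
      exact a.ne_zero (by rw [← hb, zero_pow hn])
    exact ⟨Units.mk0 b hb0, Units.ext hb⟩
  let _ : RootableBy ℂˣ ℕ := rootableByOfPowLeftSurj _ _ hroot
  let _ : RootableBy ℂˣ ℤ := Group.rootableByIntOfRootableByNat ℂˣ
  let _ : DivisibleBy (Additive ℂˣ) ℤ :=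
    { div := fun a n => Additive.ofMul (RootableBy.root a.toMul n)
      div_zero := fun a => RootableBy.root_zero (α := ℤ) a.toMul
      div_cancel := fun a hn => RootableBy.root_cancel a.toMul hn }
  obtain ⟨g, hg⟩ := (Module.Baer.of_divisible (Additive ℂˣ)).extension_property_addMonoidHom
    (MonoidHom.toAdditive (QuotientGroup.kerLift f)) (QuotientGroup.kerLift_injective f)
    (MonoidHom.toAdditive (QuotientGroup.lift f.ker χ h))
  refine ⟨MonoidHom.toAdditive.symm g, MonoidHom.ext fun a => ?_⟩
  exact DFunLike.congr_fun hg (Additive.ofMul (a : A ⧸ f.ker))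

theorem finite_commutator_of_finite_quotient_center {G K : Type*} [Group G] [Group K] [Finite K]
    (f : G →* K) (h : f.ker ≤ Subgroup.center G) : Finite (commutator G) := by
  have hfin : (commutatorSet G).Finite := by
    -- The value `1` off the range of `f` is never used: `s` is only compared with `f` at points `f
    -- g`.
    let s : K → G := fun a => by
      classical exact if h : ∃ g, f g = a then h.choose else 1
    have hs : ∀ g, f (s (f g)) = f g := fun g => by
      have hg : ∃ g', f g' = f g := ⟨g, rfl⟩
      simp only [s, dif_pos hg]
      exact hg.choose_spec
    refine (Set.finite_range fun p : K × K => ⁅s p.1, s p.2⁆).subset ?_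
    rintro _ ⟨a, b, rfl⟩
    refine ⟨(f a, f b), ?_⟩
    have key : ∀ g, ∃ z ∈ Subgroup.center G, g = s (f g) * z := fun g =>
      ⟨(s (f g))⁻¹ * g, h (by rw [MonoidHom.mem_ker, map_mul, map_inv, hs, inv_mul_cancel]),
        (mul_inv_cancel_left _ _).symm⟩
    obtain ⟨z, hz, ha⟩ := key a
    obtain ⟨w, hw, hb⟩ := key b
    rw [Subgroup.mem_center_iff] at hz hw
    -- Commutators ignore central factors, so they depend only on the images in the finite group
    -- `K`.
    have e1 : ∀ x y : G, ⁅x * z, y⁆ = ⁅x, y⁆ := fun x y => by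
      rw [commutatorElement_def, commutatorElement_def, mul_inv_rev, mul_assoc x, ← hz y,
        ← mul_assoc x y, mul_assoc (x * y), mul_inv_cancel_left]
    have e2 : ∀ x y : G, ⁅x, y * w⁆ = ⁅x, y⁆ := fun x y => by
      rw [commutatorElement_def, commutatorElement_def, mul_inv_rev, ← mul_assoc x y,
        mul_assoc (x * y) w, ← hw x⁻¹, mul_assoc (x * y), mul_assoc x⁻¹, mul_inv_cancel_left,
        mul_assoc (x * y)]
    have e3 : ⁅a, b⁆ = ⁅s (f a) * z, s (f b) * w⁆ := by rw [← ha, ← hb]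
    rw [e3, e1, e2]
  -- Schur's theorem: a group with finitely many commutators has a finite commutator subgroup.
  have := hfin.to_subtype
  infer_instance

end Divisible

/-! ### The torsion of `Z₀` and the kernel of the transgression. -/

section Torsion

variable {Q : Type*} [Quandle Q]

/-- The abelianization of `G(Q)` is torsion-free. -/
theorem mem_commutator_of_isOfFinOrder {g : Rack.EnvelGroup Q} (hg : IsOfFinOrder g) :
    g ∈ commutator (Rack.EnvelGroup Q) := by
  let q : Q → Abelianization (Rack.EnvelGroup Q) := fun x =>
    Abelianization.of (Rack.toEnvelGroup Q x : Rack.EnvelGroup Q)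
  have hq : ∀ x y : Q, q (x ◃ y) = q y := fun x y => by
    have h : (Rack.toEnvelGroup Q (x ◃ y) : Rack.EnvelGroup Q) =
      (Rack.toEnvelGroup Q x : Rack.EnvelGroup Q) * (Rack.toEnvelGroup Q y : Rack.EnvelGroup Q) *
        (Rack.toEnvelGroup Q x : Rack.EnvelGroup Q)⁻¹ := (Rack.toEnvelGroup Q).map_act
    change Abelianization.of _ = _
    rw [h, map_mul, map_mul, map_inv, mul_comm (Abelianization.of _), mul_inv_cancel_right]
  -- The target is free abelian on the classes of the generators. Since `ψ` below carries the
  -- extension of `f` back to `Abelianization.of`, whatever `f` kills lies in the commutator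
  -- subgroup.
  let f : Q →◃ Quandle.Conj (Multiplicative (Set.range q →₀ ℤ)) :=
    { toFun := fun x => Multiplicative.ofAdd (Finsupp.single ⟨q x, x, rfl⟩ 1)
      map_act' := fun {x y} => by
        rw [Quandle.conj_act_eq_conj]
        refine Eq.trans ?_ (mul_inv_cancel_comm (G := Multiplicative (Set.range q →₀ ℤ)) _ _).symm
        simp only [hq] }
  let ψ : (Set.range q →₀ ℤ) →+ Additive (Abelianization (Rack.EnvelGroup Q)) :=
    Finsupp.liftAddHom fun t => zmultiplesHom _ (Additive.ofMul (t : Abelianization _))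
  have hψ : ∀ g, ψ (Rack.toEnvelGroup.map f g).toAdd = Additive.ofMul (Abelianization.of g) := by
    intro g
    induction g using envel_induction with
    | one => simp
    | gen x =>
      rw [envelMap_toEnvelGroup]
      change ψ (Finsupp.single _ _) = _
      simp [ψ, q]
    | mul a b ha hb => simp only [map_mul, toAdd_mul, map_add, ha, hb, ofMul_mul]
    | inv a ha => simp only [map_inv, toAdd_inv, map_neg, ha, ofMul_inv]
  have h1 : Rack.toEnvelGroup.map f g = 1 :=
    (isOfFinOrder_iff_eq_one _).1 ((Rack.toEnvelGroup.map f).isOfFinOrder hg)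
  have h2 := hψ g
  rw [h1, toAdd_one, map_zero] at h2
  rw [← Abelianization.ker_of]
  exact h2.symm

/-- Restriction of characters of `Z₀` to the torsion subgroup. -/
def restrictTorsion (Q : Type*) [Quandle Q] :
    (Z0 Q →* ℂˣ) →* (CommGroup.torsion (Z0 Q) →* ℂˣ) :=
  MonoidHom.compHom' (CommGroup.torsion (Z0 Q)).subtype

theorem restrictTorsion_surjective : Function.Surjective (restrictTorsion Q) := fun χ => by
  obtain ⟨ψ, hψ⟩ := exists_monoidHom_comp_eq (CommGroup.torsion (Z0 Q)).subtype χ (by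
    rw [(MonoidHom.ker_eq_bot_iff _).2 (Subgroup.subtype_injective _)]
    exact bot_le)
  exact ⟨ψ, hψ⟩

variable [Finite Q]

instance : Finite (Inn Q) := inferInstanceAs (Finite (Inn Q : Subgroup (Equiv.Perm Q)))

instance finite_commutator_envelGroup : Finite (commutator (Rack.EnvelGroup Q)) :=
  finite_commutator_of_finite_quotient_center (envelToInn Q) fun _ hz =>
    Subgroup.mem_center_iff.2 fun g => (Z0_comm hz g).symm

theorem mem_torsion_Z0_iff (z : Z0 Q) :
    z ∈ CommGroup.torsion (Z0 Q) ↔ (z : Rack.EnvelGroup Q) ∈ commutator (Rack.EnvelGroup Q) := by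
  have h1 : IsOfFinOrder (z : Rack.EnvelGroup Q) ↔ IsOfFinOrder z :=
    (Subgroup.subtype_injective (Z0 Q)).isOfFinOrder_iff (f := (Z0 Q).subtype)
  refine h1.symm.trans ⟨mem_commutator_of_isOfFinOrder, fun h => ?_⟩
  exact (commutator (Rack.EnvelGroup Q)).subtype.isOfFinOrder (isOfFinOrder_of_finite ⟨_, h⟩)

instance finite_torsion_Z0 : Finite (CommGroup.torsion (Z0 Q)) :=
  Finite.of_injective
    (fun z => (⟨z.1, (mem_torsion_Z0_iff z.1).1 z.2⟩ : commutator (Rack.EnvelGroup Q)))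
    fun _ _ h => Subtype.ext (Subtype.ext (congrArg (commutator (Rack.EnvelGroup Q)).subtype h))

/-- A character of `G(Q)` kills commutators, hence `Tor(Z₀)`. Conversely, a character trivial on
`Tor(Z₀)` factors through the image of `Z₀` in the abelianization and extends from there. -/
theorem ker_transgression : (transgression (Q := Q)).ker = (restrictTorsion Q).ker := by
  ext χ
  rw [MonoidHom.mem_ker, MonoidHom.mem_ker, transgression_eq_one_iff]
  constructor
  · rintro ⟨ψ, hψ⟩
    refine MonoidHom.ext fun z => ?_
    change χ z.1 = 1
    rw [← hψ]
    exact Abelianization.commutator_subset_ker ψ ((mem_torsion_Z0_iff z.1).1 z.2)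
  · intro h
    obtain ⟨ψ, hψ⟩ := exists_monoidHom_comp_eq
      ((Abelianization.of (G := Rack.EnvelGroup Q)).comp (Z0 Q).subtype) χ (fun z hz => by
        have hz' : (z : Rack.EnvelGroup Q) ∈ (Abelianization.of (G := Rack.EnvelGroup Q)).ker := hz
        rw [Abelianization.ker_of] at hz'
        exact DFunLike.congr_fun h ⟨z, (mem_torsion_Z0_iff z).2 hz'⟩)
    exact ⟨ψ.comp Abelianization.of, fun z => DFunLike.congr_fun hψ z⟩

theorem nonempty_range_transgression_mulEquiv :
    Nonempty ((transgression (Q := Q)).range ≃* CommGroup.torsion (Z0 Q)) := by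
  obtain ⟨e⟩ := CommGroup.monoidHom_mulEquiv_of_hasEnoughRootsOfUnity
    (CommGroup.torsion (Z0 Q)) ℂ
  exact ⟨(QuotientGroup.quotientKerEquivRange _).symm.trans
    ((QuotientGroup.quotientMulEquivOfEq ker_transgression).trans
      ((QuotientGroup.quotientKerEquivOfSurjective _ restrictTorsion_surjective).trans e))⟩

end Torsion

/-! ### Schur's lemma in countable dimension. -/

section Schur

open Polynomial

variable {V : Type*} [AddCommGroup V] [Module ℂ V]

theorem isUnit_aeval_of_forall_isUnit_sub {A : Type*} [Ring A] [Algebra ℂ A] {T : A}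
    (hT : ∀ c : ℂ, IsUnit (T - algebraMap ℂ A c)) {p : ℂ[X]} (hp : p ≠ 0) :
    IsUnit (aeval T p) := by
  by_contra h
  have hp' := (IsAlgClosed.splits p).eq_prod_roots
  rw [hp', map_mul, aeval_C] at h
  have hu : IsUnit (algebraMap ℂ A p.leadingCoeff) :=
    (IsUnit.mk0 _ (leadingCoeff_ne_zero.2 hp)).map _
  obtain ⟨k, hk, -⟩ := spectrum.exists_mem_of_not_isUnit_aeval_prod (p := p) (a := T)
    fun h' => h (hu.mul h')
  exact hk (IsUnit.sub_iff.1 (hT k))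

/-- Resolvents applied to a nonzero vector are linearly independent when the spectrum is empty. -/
theorem linearIndependent_resolvent {T : Module.End ℂ V}
    (hT : ∀ c : ℂ, IsUnit (T - algebraMap ℂ (Module.End ℂ V) c)) {v : V} (hv : v ≠ 0)
    {w : ℂ → V} (hw : ∀ c, (T - algebraMap ℂ (Module.End ℂ V) c) (w c) = v) :
    LinearIndependent ℂ w := by
  classical
  rw [linearIndependent_iff']
  intro s a hs c hc
  -- The numerator of `∑ a d / (X - d)`. It annihilates `v` at `T`, so it vanishes, and evaluating
  -- it at `c` isolates `a c`.
  let q : ℂ[X] := ∑ d ∈ s, C (a d) * ∏ e ∈ s.erase d, (X - C e)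
  have h1 : ∀ d ∈ s, aeval T (∏ e ∈ s, (X - C e)) (w d) =
      aeval T (∏ e ∈ s.erase d, (X - C e)) v := fun d hd => by
    rw [← Finset.prod_erase_mul _ _ hd, map_mul, Module.End.mul_apply, map_sub, aeval_X, aeval_C,
      hw]
  have h2 : aeval T q v = 0 := by
    have h3 := congrArg (aeval T (∏ e ∈ s, (X - C e))) hs
    rw [map_zero, map_sum] at h3
    rw [← h3]
    simp only [q, map_sum, LinearMap.sum_apply, map_smul, map_mul, Module.End.mul_apply, aeval_C,
      Module.algebraMap_end_apply]
    exact Finset.sum_congr rfl fun d hd => by rw [h1 d hd]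
  have h4 : q = 0 := by
    by_contra hq
    have h5 := isUnit_aeval_of_forall_isUnit_sub hT hq
    exact hv (((Module.End.isUnit_iff _).1 h5).1 (by rw [h2, map_zero]))
  have h6 : eval c q = a c * ∏ e ∈ s.erase c, (c - e) := by
    simp only [q, eval_finsetSum, eval_mul, eval_C, eval_prod, eval_sub, eval_X]
    refine Finset.sum_eq_single_of_mem c hc fun d hd hdc => ?_
    rw [Finset.prod_eq_zero (Finset.mem_erase.2 ⟨hdc.symm, hc⟩) (sub_self c), mul_zero]
  rw [h4, eval_zero] at h6
  refine (mul_eq_zero.1 h6.symm).resolve_right (Finset.prod_ne_zero_iff.2 fun e he => ?_)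
  exact sub_ne_zero.2 (Finset.ne_of_mem_erase he).symm

/-- **Schur's lemma** in countable dimension. -/
theorem exists_eq_algebraMap_of_commute [Nontrivial V] {ι : Type*} [Countable ι]
    {f : ι → Module.End ℂ V}
    (hf : ∀ W : Submodule ℂ V, (∀ i, ∀ w ∈ W, f i w ∈ W) → W = ⊥ ∨ W = ⊤)
    {T : Module.End ℂ V} (hT : ∀ i, Commute T (f i)) :
    ∃ c : ℂ, T = algebraMap ℂ (Module.End ℂ V) c := by
  -- If `T` is not scalar, every `T - c` is bijective, its kernel and range being stable. The
  -- resolvents then give a continuum of independent vectors, whereas words in the `f i` applied to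
  -- `v` span `V` and are countably many.
  by_contra! hne
  have hcomm : ∀ c i w, (T - algebraMap ℂ (Module.End ℂ V) c) (f i w) =
      f i ((T - algebraMap ℂ (Module.End ℂ V) c) w) := fun c i w =>
    LinearMap.congr_fun ((hT i).sub_left (Algebra.commutes c (f i))) w
  have hunit : ∀ c : ℂ, IsUnit (T - algebraMap ℂ (Module.End ℂ V) c) := fun c => by
    rw [Module.End.isUnit_iff]
    constructor
    · rw [← LinearMap.ker_eq_bot]
      refine (hf _ fun i w hw => ?_).resolve_right fun h => ?_
      · rw [LinearMap.mem_ker] at hw ⊢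
        rw [hcomm, hw, map_zero]
      · exact hne c (sub_eq_zero.1 (LinearMap.ker_eq_top.1 h))
    · rw [← LinearMap.range_eq_top]
      refine (hf _ ?_).resolve_left fun h => ?_
      · rintro i _ ⟨w, rfl⟩
        exact ⟨f i w, hcomm c i w⟩
      · exact hne c (sub_eq_zero.1 (LinearMap.range_eq_bot.1 h))
  obtain ⟨v, hv⟩ := exists_ne (0 : V)
  choose w hw using fun c => ((Module.End.isUnit_iff _).1 (hunit c)).2 v
  have hli := linearIndependent_resolvent hunit hv hw
  have hspan : Submodule.span ℂ (Set.range fun l : List ι => (l.map f).prod v) = ⊤ := by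
    refine (hf _ fun i => ?_).resolve_left fun h => ?_
    · change Submodule.span ℂ _ ≤ (Submodule.span ℂ _).comap (f i)
      rw [Submodule.span_le]
      rintro _ ⟨l, rfl⟩
      refine Submodule.subset_span ⟨i :: l, ?_⟩
      simp
    · refine hv ((Submodule.mem_bot ℂ).1 (h ▸ Submodule.subset_span ⟨[], ?_⟩))
      simp
  have hrank : Module.rank ℂ V ≤ Cardinal.aleph0 := by
    rw [← rank_top ℂ V, ← hspan]
    exact (rank_span_le _).trans (Cardinal.mk_le_aleph0_iff.2 (Set.countable_range _).to_subtype)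
  have h1 := hli.cardinal_lift_le_rank
  have h2 := h1.trans (Cardinal.lift_le.2 hrank)
  rw [Cardinal.mk_complex, Cardinal.lift_continuum, Cardinal.lift_aleph0] at h2
  exact h2.not_gt Cardinal.aleph0_lt_continuum

end Schur

/-! ### Central characters and induced projective representations. -/

section CentralCharacter

variable {Q : Type*} [Quandle Q] {V : Type*} [AddCommGroup V] [Module ℂ V]

/-- `Z₀` acts through `ρ` by the scalars `χ`. -/
def HasCentralCharacter (ρ : Q →◃ Quandle.Conj (LinearMap.GeneralLinearGroup ℂ V))
    (χ : Z0 Q →* ℂˣ) : Prop :=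
  ∀ z : Z0 Q, Rack.toEnvelGroup.map ρ z = scalarGL V (χ z)

variable {ρ : Q →◃ Quandle.Conj (LinearMap.GeneralLinearGroup ℂ V)} {χ : Z0 Q →* ℂˣ}
  {P : Inn Q →* PGL V}

theorem mk_scalarGL (c : ℂˣ) : ((scalarGL V c : LinearMap.GeneralLinearGroup ℂ V) : PGL V) = 1 :=
  (QuotientGroup.eq_one_iff _).2 ⟨c, rfl⟩

theorem IsIrreducibleRep.exists_hasCentralCharacter [Finite Q] (hρ : IsIrreducibleRep ρ) :
    ∃ χ, HasCentralCharacter ρ χ := by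
  have := hρ.1
  have key : ∀ z : Z0 Q, ∃ c : ℂˣ, Rack.toEnvelGroup.map ρ z = scalarGL V c := fun z => by
    obtain ⟨c, hc⟩ := exists_eq_algebraMap_of_commute
      (f := fun x : Q => ((ρ x : LinearMap.GeneralLinearGroup ℂ V) : Module.End ℂ V)) hρ.2
      (T := (Rack.toEnvelGroup.map ρ z : LinearMap.GeneralLinearGroup ℂ V)) fun x => by
        have h := congrArg (Rack.toEnvelGroup.map ρ) (Z0_comm z.2 (Rack.toEnvelGroup Q x))
        rw [map_mul, map_mul, envelMap_toEnvelGroup] at h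
        exact congrArg Units.val h
    have hc0 : c ≠ 0 := by
      rintro rfl
      rw [map_zero] at hc
      exact (Units.ne_zero _) hc
    exact ⟨Units.mk0 c hc0, Units.ext hc⟩
  choose χ hχ using key
  refine ⟨MonoidHom.mk' χ fun a b => scalarGL_injective V ?_, hχ⟩
  rw [map_mul, ← hχ, ← hχ, ← hχ, Subgroup.coe_mul, map_mul]

theorem HasCentralCharacter.map_eq (h : HasCentralCharacter ρ χ) (g : Rack.EnvelGroup Q) :
    Rack.toEnvelGroup.map ρ g =
      scalarGL V (χ (centralPart g)) * Rack.toEnvelGroup.map ρ (innSection (envelToInn Q g)) := by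
  rw [← h, ← map_mul, centralPart_mul_innSection]

theorem HasCentralCharacter.map_innSection_mul (h : HasCentralCharacter ρ χ) (a b : Inn Q) :
    Rack.toEnvelGroup.map ρ (innSection (a * b)) = scalarGL V (χ (innFactor (a, b))) *
      (Rack.toEnvelGroup.map ρ (innSection a) * Rack.toEnvelGroup.map ρ (innSection b)) := by
  rw [innSection_mul, map_mul, map_mul, h]

/-- A subspace stable under the generators is stable under the whole of `G(Q)`. -/
theorem HasCentralCharacter.stable [Finite Q] (h : HasCentralCharacter ρ χ) {W : Submodule ℂ V}
    (hW : ∀ x : Q, ∀ w ∈ W, ((ρ x : LinearMap.GeneralLinearGroup ℂ V) : Module.End ℂ V) w ∈ W)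
    (g : Rack.EnvelGroup Q) : ∀ w ∈ W,
      ((Rack.toEnvelGroup.map ρ g : LinearMap.GeneralLinearGroup ℂ V) : Module.End ℂ V) w ∈ W := by
  induction g using envel_induction with
  | one => intro w hw; rw [map_one]; exact hw
  | gen x => exact hW x
  | mul a b ha hb => intro w hw; rw [map_mul]; exact ha _ (hb _ hw)
  | inv a ha =>
    have hpow : ∀ n : ℕ, ∀ w ∈ W,
        ((Rack.toEnvelGroup.map ρ (a ^ n) : LinearMap.GeneralLinearGroup ℂ V) :
          Module.End ℂ V) w ∈ W := fun n => by
      induction n with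
      | zero => intro w hw; rw [pow_zero, map_one]; exact hw
      | succ n ih => intro w hw; rw [pow_succ, map_mul]; exact ih _ (ha _ hw)
    -- Some power `a ^ (m + 1)` lies in `Z₀` and acts by a scalar, so `a⁻¹` acts as `a ^ m` up to a
    -- scalar; no finite dimension is needed.
    obtain ⟨n, hn, hn'⟩ := (isOfFinOrder_of_finite (envelToInn Q a)).exists_pow_eq_one
    have hz : a ^ n ∈ Z0 Q := by
      change envelToInn Q (a ^ n) = 1
      rw [map_pow, hn']
    intro w hw
    obtain ⟨m, rfl⟩ := Nat.exists_eq_succ_of_ne_zero hn.ne'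
    have e : a⁻¹ = ((⟨_, hz⟩ : Z0 Q)⁻¹ : Z0 Q) * a ^ m := by
      change a⁻¹ = (a ^ (m + 1))⁻¹ * a ^ m
      rw [pow_succ, mul_inv_rev, inv_mul_cancel_right]
    rw [e, map_mul, h]
    exact W.smul_mem _ (hpow m _ hw)

/-- The projective representation induced by `ρ`. -/
noncomputable def HasCentralCharacter.proj (h : HasCentralCharacter ρ χ) : Inn Q →* PGL V :=
  MonoidHom.mk' (fun a => ((Rack.toEnvelGroup.map ρ (innSection a) :
    LinearMap.GeneralLinearGroup ℂ V) : PGL V)) fun a b => by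
      rw [h.map_innSection_mul, QuotientGroup.mk_mul, mk_scalarGL, one_mul, QuotientGroup.mk_mul]

theorem HasCentralCharacter.isInducedBy_proj (h : HasCentralCharacter ρ χ) :
    IsInducedBy h.proj ρ := fun g => by
  rw [h.map_eq g, QuotientGroup.mk_mul, mk_scalarGL, one_mul]
  rfl

theorem IsInducedBy.unique {P' : Inn Q →* PGL V} (h : IsInducedBy P ρ) (h' : IsInducedBy P' ρ) :
    P = P' := by
  ext a
  obtain ⟨g, rfl⟩ := envelToInn_surjective a
  rw [h, h']

theorem IsInducedBy.schurClass_eq [Nontrivial V] (hP : IsInducedBy P ρ)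
    (h : HasCentralCharacter ρ χ) : schurClass P = transgression χ :=
  _root_.schurClass_eq (s := fun a => Rack.toEnvelGroup.map ρ (innSection a))
    ⟨by simp only [innSection_one, map_one], fun a => by rw [← hP, envelToInn_innSection]⟩
    (α := fun p => χ (innFactor p)) h.map_innSection_mul

theorem IsIrreducibleRep.isIrreducibleProj (hρ : IsIrreducibleRep ρ) (hP : IsInducedBy P ρ) :
    IsIrreducibleProj P :=
  ⟨hρ.1, fun W hW => hρ.2 W fun x => hW _ _ (hP (Rack.toEnvelGroup Q x)).symm⟩

theorem IsIrreducibleProj.isIrreducibleRep [Finite Q] (hP : IsIrreducibleProj P)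
    (hi : IsInducedBy P ρ) (h : HasCentralCharacter ρ χ) : IsIrreducibleRep ρ := by
  refine ⟨hP.1, fun W hW => hP.2 W fun a T hT w hw => ?_⟩
  obtain ⟨g, rfl⟩ := envelToInn_surjective a
  rw [hi] at hT
  obtain ⟨c, hc⟩ := QuotientGroup.eq.1 hT.symm
  have e : T = scalarGL V c * Rack.toEnvelGroup.map ρ g := by
    rw [scalarGL_comm, hc, mul_inv_cancel_left]
  rw [e]
  exact W.smul_mem _ (h.stable hW g w hw)

/-- A projective representation whose class is the transgression of `χ` is induced by a
representation of `Q` with central character `χ`. -/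
theorem exists_isInducedBy_of_schurClass_eq [Nontrivial V] (P : Inn Q →* PGL V)
    (hP : schurClass P = transgression χ) :
    ∃ ρ : Q →◃ Quandle.Conj (LinearMap.GeneralLinearGroup ℂ V),
      IsInducedBy P ρ ∧ HasCentralCharacter ρ χ := by
  obtain ⟨s, hs⟩ := exists_isLift P
  obtain ⟨α, hα⟩ := hs.exists_isFactorSet
  rw [schurClass_eq hs hα] at hP
  obtain ⟨x, hx⟩ := QuotientGroup.eq.1 hP
  have hx' : ∀ a b, x b / x (a * b) * x a = (α (a, b))⁻¹ * χ (innFactor (a, b)) := fun a b =>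
    congrFun (congrArg Subtype.val hx) (a, b)
  have hy : ∀ a b, (x (a * b))⁻¹ * α (a, b) = χ (innFactor (a, b)) * ((x a)⁻¹ * (x b)⁻¹) :=
    fun a b => by
      rw [inv_mul_eq_iff_eq_mul.1 (hx' a b).symm, div_eq_mul_inv, ← mul_inv,
        mul_right_comm (x b), mul_comm (x b), mul_assoc (α _), mul_inv_cancel_comm, mul_comm]
  -- Rescaling the lift by `x⁻¹` replaces `α` by the cohomologous cocycle `χ ∘ innFactor`.
  have ht : ∀ a b, scalarGL V (x (a * b))⁻¹ * s (a * b) = scalarGL V (χ (innFactor (a, b))) *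
      (scalarGL V (x a)⁻¹ * s a * (scalarGL V (x b)⁻¹ * s b)) := fun a b => by
    rw [hα a b, ← mul_assoc, ← map_mul, hy, map_mul, map_mul, mul_assoc, mul_assoc, mul_assoc,
      ← mul_assoc (s a), ← scalarGL_comm _ (s a), mul_assoc]
  let F := extendByCharacter (scalarGL V) scalarGL_comm χ
    (fun a => scalarGL V (x a)⁻¹ * s a) ht
  have hF : Rack.toEnvelGroup.map (Rack.toEnvelGroup.map.symm F) = F :=
    Equiv.apply_symm_apply _ F
  refine ⟨Rack.toEnvelGroup.map.symm F, fun g => ?_, fun z => ?_⟩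
  · rw [hF, ← hs.2]
    change _ = ((scalarGL V _ * (scalarGL V _ * _) : LinearMap.GeneralLinearGroup ℂ V) : PGL V)
    rw [QuotientGroup.mk_mul, QuotientGroup.mk_mul, mk_scalarGL, mk_scalarGL, one_mul, one_mul]
  · rw [hF]
    exact extendByCharacter_coe z

end CentralCharacter

/-! ### Realizing every character of `Z₀` as a central character. -/

section Existence

variable {Q : Type*} [Quandle Q]

/-- The cocycle rule for right multiplication on the cosets of `Z₀`; it makes `inducedRep`
multiplicative. -/
theorem centralPart_innSection_mul (a : Inn Q) (g h : Rack.EnvelGroup Q) :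
    centralPart (innSection a * (g * h)) =
      centralPart (innSection a * g) * centralPart (innSection (a * envelToInn Q g) * h) := by
  apply Subtype.ext
  simp [centralPart, envelToInn_innSection, mul_assoc]

/-- The representation of `G(Q)` induced from the character `χ` of `Z₀`, in coordinates. -/
noncomputable def inducedRep (χ : Z0 Q →* ℂˣ) :
    Rack.EnvelGroup Q →* Module.End ℂ (Inn Q → ℂ) where
  toFun g :=
    { toFun := fun f a => (χ (centralPart (innSection a * g)) : ℂ) * f (a * envelToInn Q g)
      map_add' := fun f f' => funext fun a => mul_add _ _ _
      map_smul' := fun c f => funext fun a => mul_left_comm _ _ _ }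
  map_one' := by
    refine LinearMap.ext fun f => funext fun a => ?_
    change (χ (centralPart (innSection a * 1)) : ℂ) * f (a * envelToInn Q 1) = f a
    have h : centralPart (innSection a) = 1 := Subtype.ext (by
      simp [centralPart, envelToInn_innSection])
    rw [mul_one, h, map_one, map_one, mul_one, Units.val_one, one_mul]
  map_mul' g h := by
    refine LinearMap.ext fun f => funext fun a => ?_
    change (χ (centralPart (innSection a * (g * h))) : ℂ) * f (a * envelToInn Q (g * h)) =
      (χ (centralPart (innSection a * g)) : ℂ) *
        ((χ (centralPart (innSection (a * envelToInn Q g) * h)) : ℂ) *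
          f (a * envelToInn Q g * envelToInn Q h))
    rw [centralPart_innSection_mul, map_mul, map_mul, Units.val_mul, mul_assoc, mul_assoc a]

theorem inducedRep_coe (χ : Z0 Q →* ℂˣ) (z : Z0 Q) :
    inducedRep χ z = algebraMap ℂ _ (χ z : ℂ) := by
  refine LinearMap.ext fun f => funext fun a => ?_
  change (χ (centralPart (innSection a * z)) : ℂ) * f (a * envelToInn Q z) = (χ z : ℂ) * f a
  have h : envelToInn Q z = 1 := z.2
  have h' : centralPart (innSection a * (z : Rack.EnvelGroup Q)) = z := Subtype.ext (by
    rw [← Z0_comm z.2]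
    simp [centralPart, envelToInn_innSection, h])
  rw [h, h', mul_one]

/-- A nonzero finite-dimensional space with operators has a minimal nonzero stable subspace. -/
theorem exists_minimal_stable {ι V : Type*} [AddCommGroup V] [Module ℂ V]
    [FiniteDimensional ℂ V] [Nontrivial V] (f : ι → Module.End ℂ V) :
    ∃ U : Submodule ℂ V, U ≠ ⊥ ∧ (∀ i, ∀ w ∈ U, f i w ∈ U) ∧
      ∀ W : Submodule ℂ V, W ≤ U → (∀ i, ∀ w ∈ W, f i w ∈ W) → W = ⊥ ∨ W = U := by
  obtain ⟨U, ⟨hU, hU'⟩, hmin⟩ := (wellFounded_lt (α := Submodule ℂ V)).has_min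
    {U | U ≠ ⊥ ∧ ∀ i, ∀ w ∈ U, f i w ∈ U} ⟨⊤, top_ne_bot, fun _ _ _ => Submodule.mem_top⟩
  refine ⟨U, hU, hU', fun W hWU hW => or_iff_not_imp_left.2 fun hne => ?_⟩
  by_contra hWU'
  exact hmin W ⟨hne, hW⟩ (lt_of_le_of_ne hWU hWU')

/-- Every character of `Z₀` is the central character of an irreducible representation of `Q`. -/
theorem exists_isIrreducibleRep_hasCentralCharacter [Finite Q] (χ : Z0 Q →* ℂˣ) :
    ∃ (V : Type) (_ : AddCommGroup V) (_ : Module ℂ V)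
      (ρ : Q →◃ Quandle.Conj (LinearMap.GeneralLinearGroup ℂ V)),
      IsIrreducibleRep ρ ∧ HasCentralCharacter ρ χ := by
  -- Passing to `Fin n → ℂ` puts the space in `Type`, whatever the universe of `Q`.
  obtain ⟨n, ⟨e⟩⟩ := Finite.exists_equiv_fin (Inn Q)
  let σ : Rack.EnvelGroup Q →* Module.End ℂ (Fin n → ℂ) :=
    ((LinearEquiv.funCongrLeft ℂ ℂ e.symm).conjAlgEquiv ℂ : _ →* _).comp (inducedRep χ)
  have hσ : ∀ z : Z0 Q, σ z = algebraMap ℂ _ (χ z : ℂ) := fun z => by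
    change LinearEquiv.conjAlgEquiv ℂ _ (inducedRep χ z) = _
    rw [inducedRep_coe, AlgEquiv.commutes]
  have : Nonempty (Fin n) := ⟨e 1⟩
  obtain ⟨U, hU, hstab, hmin⟩ := exists_minimal_stable σ
  let τ : Rack.EnvelGroup Q →* Module.End ℂ U :=
    { toFun := fun g => (σ g).restrict (hstab g)
      map_one' := LinearMap.ext fun w => Subtype.ext (by simp)
      map_mul' := fun g h => LinearMap.ext fun w => Subtype.ext (by simp) }
  let F : Rack.EnvelGroup Q →* LinearMap.GeneralLinearGroup ℂ U := τ.toHomUnits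
  have hF : Rack.toEnvelGroup.map (Rack.toEnvelGroup.map.symm F) = F :=
    Equiv.apply_symm_apply _ F
  have hχ : HasCentralCharacter (Rack.toEnvelGroup.map.symm F) χ := fun z => by
    rw [hF]
    refine Units.ext (LinearMap.ext fun w => Subtype.ext ?_)
    exact LinearMap.congr_fun (hσ z) w
  refine ⟨U, inferInstance, inferInstance, _, ⟨Submodule.nontrivial_iff_ne_bot.2 hU,
    fun W hW => ?_⟩, hχ⟩
  -- Minimality of `U` concerns subspaces stable under all of `G(Q)`, but `hW` covers only the
  -- generators.
  have hW' := hχ.stable hW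
  rw [hF] at hW'
  refine (hmin (W.map U.subtype) (Submodule.map_subtype_le _ _) ?_).imp (fun h => ?_) fun h => ?_
  · rintro g _ ⟨w, hw, rfl⟩
    exact ⟨_, hW' g w hw, rfl⟩
  · exact Submodule.map_injective_of_injective U.injective_subtype
      (h.trans (Submodule.map_bot _).symm)
  · exact Submodule.map_injective_of_injective U.injective_subtype
      (h.trans (Submodule.map_subtype_top U).symm)

end Existence

/-! ### The main theorem, with `M_Q` as the image of the transgression. -/

theorem mainTheorem5 {Q : Type u} [Quandle Q] [Finite Q] :
    ∃ M : Subgroup (SchurMultiplier (Inn Q)),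
      (M : Set (SchurMultiplier (Inn Q))) = inducedClasses Q ∧
      Finite (CommGroup.torsion (Z0 Q)) ∧
      Nonempty (M ≃* CommGroup.torsion (Z0 Q)) ∧
      (∀ (V : Type v) [AddCommGroup V] [Module ℂ V]
        (ρ : Q →◃ Quandle.Conj (LinearMap.GeneralLinearGroup ℂ V)), IsIrreducibleRep ρ →
        ∃! P : Inn Q →* PGL V, IsInducedBy P ρ ∧ IsIrreducibleProj P) ∧
      (∀ (V : Type v) [AddCommGroup V] [Module ℂ V] [Nontrivial V] (P : Inn Q →* PGL V),
        IsIrreducibleProj P →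
        (schurClass P ∈ M ↔
          ∃ ρ : Q →◃ Quandle.Conj (LinearMap.GeneralLinearGroup ℂ V),
            IsIrreducibleRep ρ ∧ IsInducedBy P ρ)) := by
  refine ⟨(transgression (Q := Q)).range, ?_, inferInstance,
    nonempty_range_transgression_mulEquiv, ?_, ?_⟩
  · refine Set.Subset.antisymm ?_ ?_
    · rintro _ ⟨χ, rfl⟩
      obtain ⟨V, i1, i2, ρ, hρ, hχ⟩ := exists_isIrreducibleRep_hasCentralCharacter χ
      have i3 := hρ.1
      exact ⟨V, i1, i2, i3, ρ, hχ.proj, hρ, hρ.isIrreducibleProj hχ.isInducedBy_proj,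
        hχ.isInducedBy_proj, hχ.isInducedBy_proj.schurClass_eq hχ⟩
    · rintro _ ⟨V, _, _, _, ρ, P, hρ, -, hP, rfl⟩
      obtain ⟨χ, hχ⟩ := hρ.exists_hasCentralCharacter
      exact ⟨χ, (hP.schurClass_eq hχ).symm⟩
  · intro V _ _ ρ hρ
    obtain ⟨χ, hχ⟩ := hρ.exists_hasCentralCharacter
    exact ⟨hχ.proj, ⟨hχ.isInducedBy_proj, hρ.isIrreducibleProj hχ.isInducedBy_proj⟩,
      fun P hP => hP.1.unique hχ.isInducedBy_proj⟩
  · intro V _ _ _ P hP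
    constructor
    · rintro ⟨χ, hχ⟩
      obtain ⟨ρ, hi, hc⟩ := exists_isInducedBy_of_schurClass_eq P hχ.symm
      exact ⟨ρ, hP.isIrreducibleRep hi hc, hi⟩
    · rintro ⟨ρ, hρ, hi⟩
      obtain ⟨χ, hχ⟩ := hρ.exists_hasCentralCharacter
      exact ⟨χ, (hi.schurClass_eq hχ).symm⟩
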